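/- Let $A$ be a complex $C^*$-algebra, not necessarily unital. A linear map $d : A \to A$ is called a derivation if $d(ab) = d(a)b + a\,d(b)$ for all $a, b \in A$. Regard $A$ as a right module over itself by right multiplication; a linear map $\delta : A \to A$ is called a generalized derivation if there exists a derivation $d : A \to A$ such that $\delta(xa) = \delta(x)a + x\,d(a)$ for all $x, a \in A$. (Neither $\delta$ nor $d$ is assumed to be continuous.) Then every generalized derivation $\delta : A \to A$ is bounded, that is, there is a constant $C \ge 0$ such that $\|\delta(x)\| \le C\|x\|$ for all $x \in A$. -/

import Mathlib

/-- A derivation on a complex, not necessarily unital, algebra `A`: a linear map `d : A → A`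
with `d (a b) = d a b + a d b`. (Mathlib's `Derivation` is for commutative algebras only.)
No continuity is assumed. -/
def IsAlgDerivation {A : Type*} [NonUnitalRing A] [Module ℂ A] (d : A →ₗ[ℂ] A) : Prop :=
  ∀ a b : A, d (a * b) = d a * b + a * d b

/-- A generalized derivation on a right `A`-module `M`: a linear map `δ : M → M` for which there
is a derivation `d` on `A` with `δ (x a) = δ x a + x d a`. The right action `x a` is written
`MulOpposite.op a • x`, which is Mathlib's encoding of right actions. Neither `δ` nor `d` is
assumed to be continuous. -/
def IsGeneralizedDerivation (A : Type*) {M : Type*} [NonUnitalRing A] [Module ℂ A]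
    [AddCommGroup M] [Module ℂ M] [SMul Aᵐᵒᵖ M] (δ : M →ₗ[ℂ] M) : Prop :=
  ∃ d : A →ₗ[ℂ] A, IsAlgDerivation d ∧
    ∀ (x : M) (a : A),
      δ (MulOpposite.op a • x) = MulOpposite.op a • δ x + MulOpposite.op (d a) • x

/-- For `A` as a right module over itself, the action is right multiplication. -/
theorem isGeneralizedDerivation_self_iff {A : Type*} [NonUnitalRing A] [Module ℂ A]
    (δ : A →ₗ[ℂ] A) :
    IsGeneralizedDerivation A δ ↔
      ∃ d : A →ₗ[ℂ] A, (∀ a b : A, d (a * b) = d a * b + a * d b) ∧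
        ∀ x a : A, δ (x * a) = δ x * a + x * d a :=
  Iff.rfl

/-!
Factor `u n = b * c n` with `c` bounded, for any sequence with `∑ ‖u n‖²` finite: if `q` is the
fourth root of `s = ∑ u n (u n)⋆`, then `u n (u n)⋆ ≤ s` makes `g q² ↦ g (u n)` a contraction on
`A q²`, whose closure contains `q`, and `c n` is the image of `q`. Since `δ (b c) = δ b c + b d c`,
the map `δ` is bounded on every such sequence as soon as `d` is continuous.

For the continuity of `d`, adjoin a unit. If `x` is self-adjoint and `‖x‖` lies in its spectrum,
then `‖x‖ - x = h²` with `h` self-adjoint and not invertible, so that `d x = -(d h h + h d h)` is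
small near the spectral value `‖x‖`. Hence `ℜ ∘ d` and `ℑ ∘ d` are dissipative on the self-adjoint
part, and everywhere defined dissipative operators are continuous by the closed graph theorem.
-/

open Filter Topology ComplexStarModule

section NormedSpace

/-- Dissipativity of an everywhere defined operator on a real normed space, in the resolvent form
`‖x‖ ≤ ‖(1 - t T) x‖`, which needs no duality map. -/
def IsDissipative {E : Type*} [NormedAddCommGroup E] [NormedSpace ℝ E] (T : E →ₗ[ℝ] E) : Prop :=
  ∀ t : ℝ, 0 < t → ∀ x, ‖x‖ ≤ ‖x - t • T x‖

variable {E F : Type*} [NormedAddCommGroup E] [NormedAddCommGroup F] [NormedSpace ℝ F]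

theorem IsDissipative.norm_le_mul_of_tendsto [NormedSpace ℝ E] {T : E →ₗ[ℝ] E}
    (hT : IsDissipative T) {u : ℕ → E} {y : E} (hu : Tendsto u atTop (𝓝 0))
    (hTu : Tendsto (fun n => T (u n)) atTop (𝓝 y)) {t : ℝ} (ht : 0 < t) :
    ‖y‖ ≤ t * ‖T y‖ := by
  have hlim : Tendsto (fun n => u n + t • y - t • T (u n + t • y)) atTop
      (𝓝 (0 + t • y - t • (y + t • T y))) := by
    simp only [map_add, map_smul]
    exact (hu.add_const _).sub ((hTu.add_const _).const_smul t)
  have hle : ‖0 + t • y‖ ≤ ‖0 + t • y - t • (y + t • T y)‖ :=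
    le_of_tendsto_of_tendsto' (hu.add_const _).norm hlim.norm fun n => hT t ht _
  have hscaled : t * ‖y‖ ≤ t * (t * ‖T y‖) := by
    simpa [smul_add, norm_smul, abs_of_pos ht] using hle
  exact le_of_mul_le_mul_left hscaled ht

theorem IsDissipative.continuous [NormedSpace ℝ E] [CompleteSpace E] {T : E →ₗ[ℝ] E}
    (hT : IsDissipative T) : Continuous T := by
  refine T.continuous_of_seq_closed_graph fun u x y hu hTu => sub_eq_zero.1 ?_
  have hu₀ : Tendsto (fun n => u n - x) atTop (𝓝 0) := by simpa using hu.sub_const x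
  have hTu₀ : Tendsto (fun n => T (u n - x)) atTop (𝓝 (y - T x)) := by
    simpa only [map_sub, Function.comp_apply] using hTu.sub_const (T x)
  have hlim : Tendsto (fun t : ℝ => t * ‖T (y - T x)‖) (𝓝[>] 0) (𝓝 0) := by
    simpa using (continuous_mul_const ‖T (y - T x)‖).continuousWithinAt.tendsto (x := (0 : ℝ))
  exact norm_le_zero_iff.1 <| ge_of_tendsto hlim <| eventually_mem_nhdsWithin.mono
    fun t ht => hT.norm_le_mul_of_tendsto hu₀ hTu₀ ht

theorem continuous_of_forall_summable_norm_sq {T : E →+ F}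
    (hT : ∀ u : ℕ → E, Summable (fun n => ‖u n‖ ^ 2) → ∃ C, ∀ n, ‖T (u n)‖ ≤ C) :
    Continuous T := by
  refine continuous_of_continuousAt_zero T ?_
  by_contra hdisc
  obtain ⟨ε, hε, hfar⟩ : ∃ ε > 0, ∀ r > 0, ∃ x, ‖x‖ < r ∧ ε ≤ ‖T x‖ := by
    simpa [Metric.continuousAt_iff] using hdisc
  have hpos (n : ℕ) : (0 : ℝ) < (1 / 2) ^ n / (n + 1) := by positivity
  choose x hx hTx using fun n => hfar _ (hpos n)
  have hnorm (n : ℕ) : ‖n • x n‖ ≤ (1 / 2) ^ n := calc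
    ‖n • x n‖ ≤ n * ‖x n‖ := norm_nsmul_le
    _ ≤ (n + 1) * ((1 / 2) ^ n / (n + 1)) := by gcongr <;> linarith [hx n]
    _ = (1 / 2) ^ n := by field_simp
  have hsum : Summable fun n => ‖n • x n‖ ^ 2 := by
    refine .of_nonneg_of_le (fun n => by positivity) (fun n => ?_)
      (summable_geometric_of_lt_one (r := (1 / 2) ^ 2) (by norm_num) (by norm_num))
    rw [pow_right_comm]
    gcongr
    exact hnorm n
  obtain ⟨C, hC⟩ := hT _ hsum
  obtain ⟨n, hn⟩ := exists_nat_gt (C / ε)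
  have hlarge : n * ε ≤ ‖T (n • x n)‖ := by
    rw [map_nsmul, ← Nat.cast_smul_eq_nsmul ℝ, norm_smul, RCLike.norm_natCast]
    gcongr
    exact hTx n
  linarith [(div_lt_iff₀ hε).1 hn, hC n]

end NormedSpace

section RealPart

variable {A : Type*} [NonUnitalCStarAlgebra A]

/-- The real part of a linear operator `T` on a C⋆-algebra, as an operator `x ↦ ℜ (T x)` on the
real Banach space of self-adjoint elements. -/
noncomputable def selfAdjointRealPart (T : A →ₗ[ℂ] A) : selfAdjoint A →ₗ[ℝ] selfAdjoint A :=
  realPart ∘ₗ T.restrictScalars ℝ ∘ₗ (selfAdjoint.submodule ℝ A).subtype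

theorem selfAdjointRealPart_apply (T : A →ₗ[ℂ] A) (x : selfAdjoint A) :
    selfAdjointRealPart T x = ℜ (T x) := rfl

theorem continuous_realPart : Continuous (realPart : A →ₗ[ℝ] selfAdjoint A) :=
  AddMonoidHomClass.continuous_of_bound realPart 1 fun x => by simpa using realPart.norm_le x

theorem continuous_of_selfAdjointRealPart {T : A →ₗ[ℂ] A}
    (hre : Continuous (selfAdjointRealPart T))
    (him : Continuous (selfAdjointRealPart (-Complex.I • T))) : Continuous T := by
  have hsa : Continuous fun x : selfAdjoint A => T x := by
    have hdecomp (x : selfAdjoint A) : T x = (selfAdjointRealPart T x : A) +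
        Complex.I • (selfAdjointRealPart (-Complex.I • T) x : A) := by
      simp [selfAdjointRealPart_apply, realPart_add_I_smul_imaginaryPart]
    simp only [hdecomp]
    exact (continuous_subtype_val.comp hre).add
      ((continuous_subtype_val.comp him).const_smul Complex.I)
  have hdecomp (x : A) : T x = T (ℜ x) + Complex.I • T (ℜ (-Complex.I • x)) := by
    conv_lhs => rw [← realPart_add_I_smul_imaginaryPart x]
    simp
  rw [funext hdecomp]
  exact (hsa.comp continuous_realPart).add
    ((hsa.comp (continuous_realPart.comp (continuous_const_smul _))).const_smul _)

theorem realPart_conjugate {A : Type*} [NonUnitalRing A] [StarRing A] [Module ℂ A] [StarModule ℂ A]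
    [IsScalarTower ℂ A A] [SMulCommClass ℂ A A] {e : A} (he : IsSelfAdjoint e) (z : A) :
    (ℜ (e * z * e) : A) = e * (ℜ z : A) * e := by
  simp [realPart_apply_coe, he.star_eq, mul_assoc, mul_add, add_mul, smul_mul_assoc,
    mul_smul_comm]

end RealPart

section Derivation

theorem IsAlgDerivation.smul {A : Type*} [NonUnitalRing A] [Module ℂ A] [IsScalarTower ℂ A A]
    [SMulCommClass ℂ A A] {d : A →ₗ[ℂ] A} (hd : IsAlgDerivation d) (z : ℂ) :
    IsAlgDerivation (z • d) := fun a b => by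
  simp [hd a b, smul_mul_assoc, mul_smul_comm]

theorem IsAlgDerivation.map_one {A : Type*} [Ring A] [Module ℂ A] {d : A →ₗ[ℂ] A}
    (hd : IsAlgDerivation d) : d 1 = 0 := by
  simpa using hd 1 1

theorem norm_conjugate_le {A : Type*} [NonUnitalSeminormedRing A] {e : A} (he : ‖e‖ = 1) (z : A) :
    ‖e * z * e‖ ≤ ‖z‖ := by
  simpa [he] using norm_mul₃_le (a := e) (b := z) (c := e)

variable {A : Type*} [CStarAlgebra A]

theorem exists_isSelfAdjoint_norm_eq_one_norm_mul_le {h : A} (hh : IsSelfAdjoint h)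
    (hunit : ¬IsUnit h) {ε : ℝ} (hε : 0 < ε) :
    ∃ e : A, IsSelfAdjoint e ∧ ‖e‖ = 1 ∧ ‖h * e‖ ≤ ε := by
  have hden (t : ℝ) : 0 < ε + |t| := by positivity
  have hcont : Continuous fun t : ℝ => ε / (ε + |t|) := by
    fun_prop (disch := exact fun t => (hden t).ne')
  refine ⟨cfc (fun t => ε / (ε + |t|)) h, cfc_predicate _ h, le_antisymm ?_ ?_, ?_⟩
  · refine norm_cfc_le zero_le_one fun t _ => ?_
    rw [Real.norm_of_nonneg (by positivity), div_le_one (hden t)]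
    linarith [abs_nonneg t]
  · simpa [hε.ne'] using norm_apply_le_norm_cfc (fun t => ε / (ε + |t|)) h
      (spectrum.zero_mem ℝ hunit) hcont.continuousOn
  · nth_rewrite 1 [← cfc_id' ℝ h]
    rw [← cfc_mul (fun t => t) _ h continuousOn_id hcont.continuousOn]
    refine norm_cfc_le hε.le fun t _ => ?_
    rw [norm_mul, Real.norm_eq_abs, Real.norm_of_nonneg (div_nonneg hε.le (hden t).le),
      mul_div_left_comm]
    exact mul_le_of_le_one_right hε.le ((div_le_one (hden t)).2 (by linarith))

theorem exists_isSelfAdjoint_mul_self_eq_algebraMap_norm_sub {x : A} (hx : IsSelfAdjoint x)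
    (hmem : ‖x‖ ∈ spectrum ℝ x) :
    ∃ h : A, IsSelfAdjoint h ∧ ¬IsUnit h ∧ h * h = algebraMap ℝ A ‖x‖ - x := by
  let _ := CStarAlgebra.spectralOrder A
  have _ := CStarAlgebra.spectralOrderedRing A
  have hsq := CFC.sqrt_mul_sqrt_self _ (sub_nonneg.2 hx.le_algebraMap_norm_self)
  exact ⟨_, .of_nonneg (CFC.sqrt_nonneg _),
    fun hunit => spectrum.mem_iff.1 hmem (hsq ▸ hunit.mul hunit), hsq⟩

theorem IsAlgDerivation.exists_norm_conjugate_le {d : A →ₗ[ℂ] A} (hd : IsAlgDerivation d)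
    {x : A} (hx : IsSelfAdjoint x) (hmem : ‖x‖ ∈ spectrum ℝ x) {ε : ℝ} (hε : 0 < ε) :
    ∃ e : A, IsSelfAdjoint e ∧ ‖e‖ = 1 ∧ ‖e * (algebraMap ℝ A ‖x‖ - x) * e‖ ≤ ε ∧
      ‖e * d x * e‖ ≤ ε := by
  obtain ⟨h, hh, hunit, hsq⟩ := exists_isSelfAdjoint_mul_self_eq_algebraMap_norm_sub hx hmem
  obtain ⟨r, hr, hr₁, hrε⟩ : ∃ r : ℝ, 0 < r ∧ r * r ≤ ε ∧ 2 * ‖d h‖ * r ≤ ε := by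
    have hlim (f : ℝ → ℝ) (hf : Continuous f) (hf₀ : f 0 = 0) : ∀ᶠ r in 𝓝[>] 0, f r ≤ ε :=
      (hf.continuousWithinAt.tendsto.eventually_lt_const (by rwa [hf₀])).mono fun _ => le_of_lt
    exact (eventually_mem_nhdsWithin.and ((hlim (fun r => r * r) (by fun_prop) (by simp)).and
      (hlim (fun r => 2 * ‖d h‖ * r) (by fun_prop) (by simp)))).exists
  obtain ⟨e, he, he₁, hre⟩ := exists_isSelfAdjoint_norm_eq_one_norm_mul_le hh hunit hr
  have hle : ‖e * h‖ ≤ r := by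
    rwa [← norm_star, star_mul, he.star_eq, hh.star_eq]
  refine ⟨e, he, he₁, ?_, ?_⟩
  · calc ‖e * (algebraMap ℝ A ‖x‖ - x) * e‖ = ‖(e * h) * (h * e)‖ := by
          rw [← hsq]; simp only [mul_assoc]
      _ ≤ r * r := norm_mul_le_of_le hle hre
      _ ≤ ε := hr₁
  · have hdx : d x = -(d h * h + h * d h) := by
      rw [← hd h h, hsq, map_sub, Algebra.algebraMap_eq_smul_one, LinearMap.map_smul_of_tower,
        hd.map_one, smul_zero, zero_sub, neg_neg]
    calc ‖e * d x * e‖ = ‖e * d h * (h * e) + e * h * (d h * e)‖ := by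
          rw [hdx, ← norm_neg]; congr 1; noncomm_ring
      _ ≤ 1 * ‖d h‖ * r + r * (‖d h‖ * 1) := by
          refine norm_add_le_of_le (norm_mul_le_of_le ?_ hre) (norm_mul_le_of_le hle ?_)
          · exact norm_mul_le_of_le he₁.le le_rfl
          · exact norm_mul_le_of_le le_rfl he₁.le
      _ = 2 * ‖d h‖ * r := by ring
      _ ≤ ε := hrε

theorem IsAlgDerivation.norm_le_norm_add_realPart_of_mem {d : A →ₗ[ℂ] A}
    (hd : IsAlgDerivation d) {x : A} (hx : IsSelfAdjoint x) (hmem : ‖x‖ ∈ spectrum ℝ x) :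
    ‖x‖ ≤ ‖x + ℜ (d x)‖ := by
  refine le_of_forall_pos_le_add fun ε hε => ?_
  obtain ⟨e, he, he₁, hxe, hde⟩ := hd.exists_norm_conjugate_le hx hmem (half_pos hε)
  have hre : ‖(ℜ (e * d x * e) : A)‖ ≤ ε / 2 := (realPart.norm_le _).trans hde
  calc ‖x‖ = ‖e * algebraMap ℝ A ‖x‖ * e‖ := by
        rw [← Algebra.commutes, mul_assoc, ← Algebra.smul_def, norm_smul, norm_norm,
          he.norm_mul_self, he₁, one_pow, mul_one]
    _ = ‖e * (x + ℜ (d x)) * e + e * (algebraMap ℝ A ‖x‖ - x) * e - ℜ (e * d x * e)‖ := by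
        rw [realPart_conjugate he]; congr 1; noncomm_ring
    _ ≤ ‖x + ℜ (d x)‖ + ε / 2 + ε / 2 :=
        norm_sub_le_of_le (norm_add_le_of_le (norm_conjugate_le he₁ _) hxe) hre
    _ = ‖x + ℜ (d x)‖ + ε := by ring

theorem IsAlgDerivation.norm_le_norm_add_realPart {d : A →ₗ[ℂ] A} (hd : IsAlgDerivation d)
    {x : A} (hx : IsSelfAdjoint x) : ‖x‖ ≤ ‖x + ℜ (d x)‖ := by
  nontriviality A
  rcases CStarAlgebra.norm_or_neg_norm_mem_spectrum hx with hmem | hmem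
  · exact hd.norm_le_norm_add_realPart_of_mem hx hmem
  · have hneg : ‖-x‖ ∈ spectrum ℝ (-x) := by
      rwa [norm_neg, ← spectrum.neg_eq, Set.mem_neg]
    have hle := hd.norm_le_norm_add_realPart_of_mem hx.neg hneg
    rwa [map_neg, map_neg, NegMemClass.coe_neg, ← neg_add, norm_neg, norm_neg] at hle

theorem IsAlgDerivation.isDissipative_selfAdjointRealPart {d : A →ₗ[ℂ] A}
    (hd : IsAlgDerivation d) : IsDissipative (selfAdjointRealPart d) := fun t _ x => by
  simpa [selfAdjointRealPart_apply, sub_eq_add_neg] using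
    (hd.smul (-t : ℝ)).norm_le_norm_add_realPart x.2

theorem IsAlgDerivation.continuous_of_unital {d : A →ₗ[ℂ] A} (hd : IsAlgDerivation d) :
    Continuous d := by
  have : CompleteSpace (selfAdjoint A) :=
    (isClosed_eq continuous_star continuous_id).completeSpace_coe
  exact continuous_of_selfAdjointRealPart hd.isDissipative_selfAdjointRealPart.continuous
    (hd.smul _).isDissipative_selfAdjointRealPart.continuous

/-- The extension `z + a ↦ d a` of an operator `d` on `A` to the unitization of `A`, along which
derivations extend to derivations. -/
def extendUnitization {A : Type*} [NonUnitalRing A] [Module ℂ A] (d : A →ₗ[ℂ] A) :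
    Unitization ℂ A →ₗ[ℂ] Unitization ℂ A :=
  Unitization.inrHom ℂ ℂ A ∘ₗ d ∘ₗ Unitization.sndHom ℂ ℂ A

theorem IsAlgDerivation.extendUnitization {A : Type*} [NonUnitalRing A] [Module ℂ A]
    [IsScalarTower ℂ A A] [SMulCommClass ℂ A A] {d : A →ₗ[ℂ] A} (hd : IsAlgDerivation d) :
    IsAlgDerivation (extendUnitization d) := fun a b => by
  ext <;> simp [_root_.extendUnitization, hd a.snd b.snd]
  abel

theorem IsAlgDerivation.continuous {A : Type*} [NonUnitalCStarAlgebra A] {d : A →ₗ[ℂ] A}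
    (hd : IsAlgDerivation d) : Continuous d :=
  Unitization.isometry_inr.isEmbedding.continuous_iff.2 <|
    hd.extendUnitization.continuous_of_unital.comp Unitization.isometry_inr.continuous

end Derivation

section Factorization

theorem norm_mul_le_norm_mul_of_mul_star_le {A : Type*} [NonUnitalCStarAlgebra A] [PartialOrder A]
    [StarOrderedRing A] {x p : A} (h : x * star x ≤ p * star p) (g : A) : ‖g * x‖ ≤ ‖g * p‖ := by
  have hconj (y : A) : g * y * star (g * y) = g * (y * star y) * star g := by
    simp only [star_mul, mul_assoc]
  refine le_of_sq_le_sq ?_ (norm_nonneg _)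
  rw [sq, sq, ← CStarRing.norm_self_mul_star, ← CStarRing.norm_self_mul_star, hconj, hconj]
  refine CStarAlgebra.norm_le_norm_of_nonneg_of_le ?_ (star_right_conjugate_le_conjugate h g)
  exact star_right_conjugate_nonneg (mul_star_self_nonneg x) g

variable {A : Type*} [NonUnitalCStarAlgebra A]

theorem mem_closure_range_mul_mul_self {q : A} (hq : IsSelfAdjoint q) :
    q ∈ closure (Set.range fun g : A => g * (q * q)) := by
  refine Metric.mem_closure_range_iff.2 fun ε hε => ?_
  obtain ⟨r, hr, hrε⟩ := exists_between hε
  have hden (t : ℝ) : 0 < r ^ 2 + t ^ 2 := by positivity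
  have hcont : Continuous fun t : ℝ => t / (r ^ 2 + t ^ 2) := by
    fun_prop (disch := exact fun t => (hden t).ne')
  refine ⟨cfcₙ (fun t : ℝ => t / (r ^ 2 + t ^ 2)) q, lt_of_le_of_lt ?_ hrε⟩
  have hsub : q - cfcₙ (fun t : ℝ => t / (r ^ 2 + t ^ 2)) q * (q * q) =
      cfcₙ (fun t : ℝ => t - t / (r ^ 2 + t ^ 2) * (t * t)) q := by
    have hcont' : Continuous fun t : ℝ => t / (r ^ 2 + t ^ 2) * (t * t) := by fun_prop
    rw [cfcₙ_sub (fun t => t) _ q (hg := hcont'.continuousOn),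
      cfcₙ_mul _ (fun t => t * t) q hcont.continuousOn,
      cfcₙ_mul (fun t => t) (fun t => t) q, cfcₙ_id' ℝ q]
  rw [dist_eq_norm, hsub]
  refine norm_cfcₙ_le fun t _ => ?_
  have hval : t - t / (r ^ 2 + t ^ 2) * (t * t) = r * (r * t / (r ^ 2 + t ^ 2)) := by
    have := (hden t).ne'
    field_simp
    ring
  rw [hval, norm_mul, Real.norm_of_nonneg hr.le, norm_div, Real.norm_of_nonneg (hden t).le]
  refine mul_le_of_le_one_right hr.le ((div_le_one (hden t)).2 (abs_le.2 ⟨?_, ?_⟩)) <;>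
    nlinarith [sq_nonneg (r + t), sq_nonneg (r - t)]

theorem exists_mul_eq_of_mul_star_le [PartialOrder A] [StarOrderedRing A] {x q : A}
    (hq : IsSelfAdjoint q) (h : x * star x ≤ q * q * star (q * q)) :
    ∃ c : A, ‖c‖ ≤ ‖q‖ ∧ q * c = x := by
  obtain ⟨_, hmem, hlim⟩ := mem_closure_iff_seq_limit.1 (mem_closure_range_mul_mul_self hq)
  choose g hg using hmem
  obtain rfl : (fun n => g n * (q * q)) = _ := funext hg
  have hcauchy : CauchySeq fun n => g n * x := by
    refine cauchySeq_iff_tendsto_dist_atTop_0.2 <| squeeze_zero (fun _ => dist_nonneg) (fun n => ?_)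
      (cauchySeq_iff_tendsto_dist_atTop_0.1 hlim.cauchySeq)
    simpa only [dist_eq_norm, ← sub_mul] using norm_mul_le_norm_mul_of_mul_star_le h _
  obtain ⟨c, hc⟩ := cauchySeq_tendsto_of_complete hcauchy
  refine ⟨c, le_of_tendsto_of_tendsto' hc.norm hlim.norm fun n =>
    norm_mul_le_norm_mul_of_mul_star_le h (g n), ?_⟩
  have hann (a : A) : a * (q * c - x) = 0 := by
    have hx : Tendsto (fun n => (a * q * g n - a) * x) atTop (𝓝 (a * (q * c - x))) := by
      simpa only [sub_mul, mul_sub, mul_assoc] using (hc.const_mul (a * q)).sub_const (a * x)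
    have hp : Tendsto (fun n => (a * q * g n - a) * (q * q)) atTop (𝓝 0) := by
      simpa only [sub_mul, mul_assoc, sub_self] using
        (hlim.const_mul (a * q)).sub_const (a * (q * q))
    exact tendsto_nhds_unique hx <| squeeze_zero_norm
      (fun n => norm_mul_le_norm_mul_of_mul_star_le h _) (tendsto_zero_iff_norm_tendsto_zero.1 hp)
  exact sub_eq_zero.1 (CStarRing.star_mul_self_eq_zero_iff _ |>.1 (hann _))

theorem exists_eq_mul_of_summable_norm_sq {u : ℕ → A} (hu : Summable fun n => ‖u n‖ ^ 2) :
    ∃ (b : A) (c : ℕ → A), (∀ n, ‖c n‖ ≤ ‖b‖) ∧ ∀ n, b * c n = u n := by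
  let _ := CStarAlgebra.spectralOrder A
  have _ := CStarAlgebra.spectralOrderedRing A
  have hsum : Summable fun n => u n * star (u n) :=
    .of_norm (by simpa only [CStarRing.norm_self_mul_star, ← sq] using hu)
  set s := ∑' n, u n * star (u n)
  have hs : 0 ≤ s := tsum_nonneg fun n => mul_star_self_nonneg _
  set q := CFC.sqrt (CFC.sqrt s)
  have hq : IsSelfAdjoint q := .of_nonneg (CFC.sqrt_nonneg _)
  have hqs : q * q * star (q * q) = s := by
    rw [star_mul, hq.star_eq, CFC.sqrt_mul_sqrt_self _ (CFC.sqrt_nonneg s),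
      CFC.sqrt_mul_sqrt_self s]
  have hle (n : ℕ) : u n * star (u n) ≤ q * q * star (q * q) :=
    hqs ▸ hsum.le_tsum n fun m _ => mul_star_self_nonneg _
  choose c hcq hc using fun n => exists_mul_eq_of_mul_star_le hq (hle n)
  exact ⟨q, c, hcq, hc⟩

theorem continuous_of_forall_continuous_const_mul {F : Type*} [NormedAddCommGroup F]
    [NormedSpace ℂ F] {T : A →ₗ[ℂ] F} (hT : ∀ b, Continuous fun c => T (b * c)) :
    Continuous T := by
  refine continuous_of_forall_summable_norm_sq (T := T.toAddMonoidHom) fun u hu => ?_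
  obtain ⟨b, c, hcb, hc⟩ := exists_eq_mul_of_summable_norm_sq hu
  let L : A →L[ℂ] F := ⟨T ∘ₗ LinearMap.mulLeft ℂ b, hT b⟩
  refine ⟨‖L‖ * ‖b‖, fun n => ?_⟩
  rw [← hc n]
  exact L.le_opNorm_of_le (hcb n)

end Factorization

theorem corollary2p3 {A : Type*} [NonUnitalCStarAlgebra A] (δ : A →ₗ[ℂ] A)
    (hδ : IsGeneralizedDerivation A δ) : IsBoundedLinearMap ℂ δ := by
  obtain ⟨d, hd, h⟩ := (isGeneralizedDerivation_self_iff δ).1 hδ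
  have hdc : Continuous d := IsAlgDerivation.continuous hd
  have hδc : Continuous δ := continuous_of_forall_continuous_const_mul fun b => by
    simp only [h]
    fun_prop
  exact (⟨δ, hδc⟩ : A →L[ℂ] A).isBoundedLinearMap
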